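/- Let $G$ be a compact Lie group and let $\rho : G \to \mathrm{GL}(V)$ be a faithful continuous representation of $G$ on a finite-dimensional complex vector space $V$ which is self-dual, i.e. $V \cong V^*$ as representations of $G$. Put $$a_4(G,V) = \dim_{\mathbb C}\bigl((V^{\otimes 4})^G\bigr),$$ the dimension of the space of $G$-invariants in the fourth tensor power of $V$. If $a_4(G,V) = 3$, then the identity component $G^\circ$ of $G$ is either a torus (isomorphic to $(S^1)^n$ for some $n \ge 0$) or a semisimple group (a connected Lie group with no nontrivial connected solvable normal subgroup). -/

import Mathlib

open scoped Manifold ContDiff TensorProduct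

/-- The representation of `G` on the `n`-fold tensor power `V ⊗ ⋯ ⊗ V`, with
`g (v₁ ⊗ ⋯ ⊗ vₙ) = g v₁ ⊗ ⋯ ⊗ g vₙ`. -/
noncomputable def Representation.tensorPow {G V : Type*} [Group G] [AddCommGroup V] [Module ℂ V]
    (ρ : Representation ℂ G V) (n : ℕ) :
    Representation ℂ G (⨂[ℂ] _ : Fin n, V) where
  toFun g := PiTensorProduct.map fun _ => ρ g
  map_one' := by
    rw [map_one]
    exact PiTensorProduct.map_one
  map_mul' g h := by
    rw [map_mul]
    exact PiTensorProduct.map_mul (fun _ => ρ g) (fun _ => ρ h)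

/-- The Sato–Tate moment `aₙ(G, V) = dim (V^{⊗ n})^G`. -/
noncomputable def Representation.satoTateMoment {G V : Type*} [Group G] [AddCommGroup V]
    [Module ℂ V] (ρ : Representation ℂ G V) (n : ℕ) : ℕ :=
  Module.finrank ℂ (ρ.tensorPow n).invariants

/-- Continuity of a finite-dimensional complex representation of a topological group:
all matrix coefficients `g ↦ f (ρ g v)` are continuous. -/
def Representation.IsContinuous {G V : Type*} [Group G] [TopologicalSpace G] [AddCommGroup V]
    [Module ℂ V] (ρ : Representation ℂ G V) : Prop :=
  ∀ (v : V) (f : Module.Dual ℂ V), Continuous fun g => f (ρ g v)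

/-- A representation is self-dual if it is isomorphic to its contragredient. -/
def Representation.IsSelfDual {G V : Type*} [Group G] [AddCommGroup V]
    [Module ℂ V] (ρ : Representation ℂ G V) : Prop :=
  Nonempty (ρ.Equiv ρ.dual)

/-- A torus: a topological group isomorphic to `(S¹)ⁿ` for some `n ≥ 0`.  (An isomorphism of
topological groups between Lie groups is automatically a diffeomorphism.) -/
def IsTorusGroup (K : Type*) [Group K] [TopologicalSpace K] : Prop :=
  ∃ n : ℕ, Nonempty (K ≃ₜ* (Fin n → Circle))

/-- A semisimple Lie group: a connected Lie group with trivial radical, i.e. without nontrivial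
connected solvable normal subgroups. -/
def IsSemisimpleGroup (K : Type*) [Group K] [TopologicalSpace K] : Prop :=
  ConnectedSpace K ∧
    ∀ N : Subgroup K, N.Normal → Group.IsSolvable N → IsConnected (N : Set K) → N = ⊥

/-! Self-duality identifies `V^{⊗4}` with `End (End V)` equivariantly, so `a₄` bounds the dimension
of `End_G (End V)`. Since `End V` is completely reducible, a chain of four nonzero invariant
subspaces, strictly increasing up to `End V`, would give four independent equivariant endomorphisms;
hence `a₄ ≤ 3` forbids it.

Let `K = G°` with center `Z`; both are normal in `G`, so `ℂ·1 ≤ span ρ(Z) ≤ span ρ(K) ≤ End V`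
consists of invariant subspaces. If `K` is nonabelian and `Z` is not scalar, all inclusions are
strict. So `K` is abelian or `Z` is scalar (`commute_or_center_scalar`).

If `K` is abelian, finitely many characters separate its points, and a basis of the group they
generate identifies `K` with a torus. If `Z` is scalar, the invariant form forces the scalars to be
`±1`. A connected solvable normal subgroup is abelian, then central, because eigenvalues cannot vary
along a connected family of commuting conjugates (`conj_eq_of_commute_conj`); being connected and
contained in `{±1}`, it is trivial. -/

namespace Representation

open MeasureTheory

/-! ### Haar averaging and complete reducibility. -/

section Average

variable {E F : Type*} [AddCommGroup E] [Module ℂ E] [FiniteDimensional ℂ E]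
  [AddCommGroup F] [Module ℂ F] [FiniteDimensional ℂ F]

/-- The functionals `X ↦ f (X v)` span the dual of `Hom(E, F)`. -/
lemma span_eval_eq_top :
    Submodule.span ℂ (Set.range fun p : Module.Dual ℂ F × E =>
      (p.1 ∘ₗ LinearMap.applyₗ p.2 : Module.Dual ℂ (E →ₗ[ℂ] F))) = ⊤ := by
  set Φ := Submodule.span ℂ (Set.range fun p : Module.Dual ℂ F × E =>
      (p.1 ∘ₗ LinearMap.applyₗ p.2 : Module.Dual ℂ (E →ₗ[ℂ] F))) with hΦ
  have h : Φ.dualCoannihilator = ⊥ := by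
    rw [Submodule.eq_bot_iff]
    intro X hX
    rw [Submodule.mem_dualCoannihilator] at hX
    ext v
    refine (Module.forall_dual_apply_eq_zero_iff ℂ _).1 fun f => ?_
    exact hX _ (Submodule.subset_span ⟨(f, v), rfl⟩)
  have := Subspace.dualCoannihilator_dualAnnihilator_eq (W := Φ)
  rw [← this, h, Submodule.dualAnnihilator_bot]

variable {G : Type*} [Group G] [TopologicalSpace G] [IsTopologicalGroup G]

/-- Functionals `X ↦ f (X v)` span the dual, and expanding `σ g⁻¹ v` in a basis turns their
coefficients into sums of products of coefficients of `σ` and `τ`. -/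
lemma IsContinuous.linHom {σ : Representation ℂ G E} {τ : Representation ℂ G F}
    (hσ : σ.IsContinuous) (hτ : τ.IsContinuous) : (σ.linHom τ).IsContinuous := by
  intro X φ
  have hφ : φ ∈ Submodule.span ℂ (Set.range fun p : Module.Dual ℂ F × E =>
      (p.1 ∘ₗ LinearMap.applyₗ p.2 : Module.Dual ℂ (E →ₗ[ℂ] F))) := by
    rw [span_eval_eq_top]; trivial
  induction hφ using Submodule.span_induction with
  | mem φ h =>
    obtain ⟨⟨f, v⟩, rfl⟩ := h
    let b := Module.finBasis ℂ E
    have h : ∀ g, f (τ g (X (σ g⁻¹ v))) = ∑ i, b.coord i (σ g⁻¹ v) * f (τ g (X (b i))) := by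
      intro g
      conv_lhs => rw [← b.sum_repr (σ g⁻¹ v)]
      simp only [map_sum, map_smul, smul_eq_mul, Module.Basis.coord_apply]
    have h' : (fun g => (f ∘ₗ LinearMap.applyₗ v) ((σ.linHom τ) g X)) =
        fun g => ∑ i, b.coord i (σ g⁻¹ v) * f (τ g (X (b i))) := by
      ext g; rw [← h]; rfl
    change Continuous (fun g => (f ∘ₗ LinearMap.applyₗ v) ((σ.linHom τ) g X))
    rw [h']
    exact continuous_finsetSum _ fun i _ => ((hσ v _).comp continuous_inv).mul (hτ _ _)
  | zero => simpa using continuous_const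
  | add φ ψ _ _ h₁ h₂ => exact h₁.add h₂
  | smul c φ _ h => exact h.const_smul c

variable [CompactSpace G]

/-- Haar averaging of vectors in a continuous representation of a compact group. -/
lemma IsContinuous.exists_average {σ : Representation ℂ G E} (hσ : σ.IsContinuous) :
    ∃ (_ : MeasurableSpace G) (_ : BorelSpace G) (μ : Measure G) (_ : IsProbabilityMeasure μ),
      ∀ v, ∃ w ∈ σ.invariants, ∀ f : Module.Dual ℂ E, f w = ∫ g, f (σ g v) ∂μ := by
  let : MeasurableSpace G := borel G
  have : BorelSpace G := ⟨rfl⟩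
  let μ : Measure G := Measure.haarMeasure ⊤
  have : IsProbabilityMeasure μ := ⟨Measure.haarMeasure_self⟩
  refine ⟨inferInstance, inferInstance, μ, inferInstance, fun v => ?_⟩
  let b := Module.finBasis ℂ E
  have hint (u : E) (f : Module.Dual ℂ E) : Integrable (fun g => f (σ g u)) μ :=
    (hσ u f).integrable_of_hasCompactSupport (HasCompactSupport.of_compactSpace _)
  -- The average is assembled from coordinate integrals; `key` characterizes it weakly, so `E` needs
  -- no norm.
  have key (f : Module.Dual ℂ E) :
      f (∑ i, (∫ g, b.coord i (σ g v) ∂μ) • b i) = ∫ g, f (σ g v) ∂μ := by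
    have : ∀ g, f (σ g v) = ∑ i, b.coord i (σ g v) * f (b i) := by
      intro g
      conv_lhs => rw [← b.sum_repr (σ g v)]
      simp only [map_sum, map_smul, smul_eq_mul, Module.Basis.coord_apply]
    simp_rw [this]
    rw [integral_finsetSum _ fun i _ => (hint v _).mul_const _]
    simp [integral_mul_const]
  refine ⟨∑ i, (∫ g, b.coord i (σ g v) ∂μ) • b i, ?_, key⟩
  intro h
  rw [← sub_eq_zero]
  refine (Module.forall_dual_apply_eq_zero_iff ℂ _).1 fun f => ?_
  rw [map_sub, sub_eq_zero, key, ← LinearMap.comp_apply f (σ h), key]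
  have := integral_mul_left_eq_self (μ := μ) (fun g => f (σ g v)) h
  simpa using this

/-- An invariant subspace of a continuous representation of a compact group is the image of an
equivariant projection. -/
lemma IsContinuous.exists_equivariant_projection {σ : Representation ℂ G E}
    (hσ : σ.IsContinuous) (W : Submodule ℂ E) (hW : ∀ g, ∀ w ∈ W, σ g w ∈ W) :
    ∃ P ∈ (σ.linHom σ).invariants, (∀ x, P x ∈ W) ∧ ∀ w ∈ W, P w = w := by
  obtain ⟨_, _, μ, _, hμ⟩ := (hσ.linHom hσ).exists_average
  obtain ⟨p, hp⟩ := W.exists_isCompl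
  -- Average the conjugates of an arbitrary linear projection onto `W`; each conjugate still maps
  -- into `W` and fixes it pointwise.
  let P₀ : E →ₗ[ℂ] E := W.subtype ∘ₗ W.projectionOnto p hp
  obtain ⟨P, hP, hPf⟩ := hμ P₀
  have hval (f : Module.Dual ℂ E) (x : E) :
      f (P x) = ∫ g, f (σ g (P₀ (σ g⁻¹ x))) ∂μ := hPf (f ∘ₗ LinearMap.applyₗ x)
  refine ⟨P, hP, fun x => ?_, fun w hw => ?_⟩
  · by_contra hx
    obtain ⟨f, hf, hfW⟩ := Submodule.exists_dual_map_eq_bot_of_notMem (p := W) hx inferInstance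
    apply hf
    rw [hval]
    have : ∀ g, f (σ g (P₀ (σ g⁻¹ x))) = 0 := fun g => by
      have : f (σ g (P₀ (σ g⁻¹ x))) ∈ W.map f :=
        Submodule.mem_map_of_mem (hW g _ (Submodule.coe_mem _))
      simpa [hfW] using this
    simp [this]
  · rw [← sub_eq_zero]
    refine (Module.forall_dual_apply_eq_zero_iff ℂ _).1 fun f => ?_
    rw [map_sub, hval]
    have : ∀ g, f (σ g (P₀ (σ g⁻¹ w))) = f w := fun g => by
      have h : P₀ (σ g⁻¹ w) = σ g⁻¹ w :=
        congrArg Subtype.val (Submodule.projectionOnto_apply_left hp ⟨_, hW g⁻¹ w hw⟩)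
      rw [h]; simp
    simp [this]

/-- A strict chain of four nonzero invariant subspaces yields four independent equivariant
endomorphisms. -/
lemma IsContinuous.four_le_finrank_invariants_linHom {σ : Representation ℂ G E}
    (hσ : σ.IsContinuous) {W₁ W₂ W₃ : Submodule ℂ E}
    (h₁ : ∀ g, ∀ w ∈ W₁, σ g w ∈ W₁) (h₂ : ∀ g, ∀ w ∈ W₂, σ g w ∈ W₂)
    (h₃ : ∀ g, ∀ w ∈ W₃, σ g w ∈ W₃)
    (h01 : ⊥ < W₁) (h12 : W₁ < W₂) (h23 : W₂ < W₃) (h34 : W₃ < ⊤) :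
    4 ≤ Module.finrank ℂ (σ.linHom σ).invariants := by
  obtain ⟨P₁, i₁, m₁, e₁⟩ := hσ.exists_equivariant_projection W₁ h₁
  obtain ⟨P₂, i₂, m₂, e₂⟩ := hσ.exists_equivariant_projection W₂ h₂
  obtain ⟨P₃, i₃, m₃, e₃⟩ := hσ.exists_equivariant_projection W₃ h₃
  obtain ⟨x₁, hx₁, hx₁'⟩ := SetLike.exists_of_lt h01
  obtain ⟨x₂, hx₂, hx₂'⟩ := SetLike.exists_of_lt h12
  obtain ⟨x₃, hx₃, hx₃'⟩ := SetLike.exists_of_lt h23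
  obtain ⟨x₄, -, hx₄'⟩ := SetLike.exists_of_lt h34
  have i₄ : (LinearMap.id : E →ₗ[ℂ] E) ∈ (σ.linHom σ).invariants := by
    intro g; ext x; simp [Representation.linHom_apply]
  let v : Fin 4 → (σ.linHom σ).invariants :=
    ![⟨P₁, i₁⟩, ⟨P₂, i₂⟩, ⟨P₃, i₃⟩, ⟨LinearMap.id, i₄⟩]
  have hv : LinearIndependent ℂ v := by
    rw [Fintype.linearIndependent_iff]
    intro c hc
    have hc' (x : E) : c 0 • P₁ x + c 1 • P₂ x + c 2 • P₃ x + c 3 • x = 0 := by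
      have := congrArg (fun q : (σ.linHom σ).invariants => (q : E →ₗ[ℂ] E) x) hc
      simpa [v, Fin.sum_univ_four] using this
    have aux {W : Submodule ℂ E} {x y : E} {a : ℂ} (hx : x ∉ W) (hy : y ∈ W)
        (h : y + a • x = 0) : a = 0 := by
      by_contra ha
      refine hx ((W.smul_mem_iff ha).1 ?_)
      rw [eq_neg_of_add_eq_zero_right h]
      exact W.neg_mem hy
    -- Triangular elimination from the top: at a vector outside `W₃` the three projections
    -- contribute only elements of `W₃`, so `c 3 = 0`; then descend the chain.
    have c3 : c 3 = 0 := by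
      refine aux hx₄' ?_ (hc' x₄)
      exact W₃.add_mem (W₃.add_mem (W₃.smul_mem _ (h23.le (h12.le (m₁ _))))
        (W₃.smul_mem _ (h23.le (m₂ _)))) (W₃.smul_mem _ (m₃ _))
    have c2 : c 2 = 0 := by
      have := hc' x₃
      rw [c3, zero_smul, add_zero, e₃ _ hx₃] at this
      exact aux hx₃' (W₂.add_mem (W₂.smul_mem _ (h12.le (m₁ _))) (W₂.smul_mem _ (m₂ _))) this
    have c1 : c 1 = 0 := by
      have := hc' x₂
      rw [c3, c2, zero_smul, zero_smul, add_zero, add_zero, e₂ _ hx₂] at this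
      exact aux hx₂' (W₁.smul_mem _ (m₁ _)) this
    have c0 : c 0 = 0 := by
      have := hc' x₁
      rw [c3, c2, c1, zero_smul, zero_smul, zero_smul, add_zero, add_zero, add_zero,
        e₁ _ hx₁] at this
      exact (smul_eq_zero.1 this).resolve_right fun h => hx₁' (by simp [h])
    intro i
    fin_cases i <;> assumption
  simpa using hv.fintype_card_le_finrank

end Average

end Representation

namespace Representation

/-! ### The fourth tensor power as `End (End V)`. -/

section FourthMoment

variable {G V : Type*} [Group G] [AddCommGroup V] [Module ℂ V]

/-- For a bilinear form `B : V → V*`, the map `V^{⊗ 4} → End (End V)` sending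
`v₀ ⊗ v₁ ⊗ v₂ ⊗ v₃` to `X ↦ B(v₀, X v₁) • (B(v₂, ·) v₃)`. -/
noncomputable def tensorToEndEnd (B : V →ₗ[ℂ] Module.Dual ℂ V) :
    (⨂[ℂ] _ : Fin 4, V) →ₗ[ℂ] ((V →ₗ[ℂ] V) →ₗ[ℂ] (V →ₗ[ℂ] V)) :=
  PiTensorProduct.lift <| MultilinearMap.mk'
    (fun v => (B (v 0) ∘ₗ LinearMap.applyₗ (v 1)).smulRight ((B (v 2)).smulRight (v 3)))
    (by
      intro v i x y
      fin_cases i <;> ext X w <;> simp [Function.update] <;> module)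
    (by
      intro v i c x
      fin_cases i <;> ext X w <;> simp [Function.update] <;> module)

lemma tensorToEndEnd_tprod (B : V →ₗ[ℂ] Module.Dual ℂ V) (v : Fin 4 → V) :
    tensorToEndEnd B (PiTensorProduct.tprod ℂ v) =
      (B (v 0) ∘ₗ LinearMap.applyₗ (v 1)).smulRight ((B (v 2)).smulRight (v 3)) := by
  simp [tensorToEndEnd]

lemma tensorToEndEnd_equivariant (ρ : Representation ℂ G V) {B : V →ₗ[ℂ] Module.Dual ℂ V}
    (hB : ∀ g v w, B (ρ g v) w = B v (ρ g⁻¹ w)) (g : G) (x : ⨂[ℂ] _ : Fin 4, V) :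
    tensorToEndEnd B (ρ.tensorPow 4 g x) =
      (ρ.linHom ρ).linHom (ρ.linHom ρ) g (tensorToEndEnd B x) := by
  have h : tensorToEndEnd B ∘ₗ ρ.tensorPow 4 g =
      (ρ.linHom ρ).linHom (ρ.linHom ρ) g ∘ₗ tensorToEndEnd B := by
    apply PiTensorProduct.ext
    ext v X w
    have h : ρ.tensorPow 4 g (PiTensorProduct.tprod ℂ v) =
        PiTensorProduct.tprod ℂ fun i => ρ g (v i) :=
      PiTensorProduct.map_tprod _ _
    simp [h, tensorToEndEnd_tprod, hB]
  exact LinearMap.congr_fun h x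

lemma IsSelfDual.exists_form {ρ : Representation ℂ G V} (hρ : ρ.IsSelfDual) :
    ∃ B : V ≃ₗ[ℂ] Module.Dual ℂ V, ∀ g v w, B.toLinearMap (ρ g v) w = B v (ρ g⁻¹ w) := by
  obtain ⟨e⟩ := hρ
  exact ⟨e.toLinearEquiv, fun g v w => LinearMap.congr_fun
    (IntertwiningMap.isIntertwining _ _ e.toIntertwiningMap g v) w⟩

variable [FiniteDimensional ℂ V]

lemma eq_top_of_smulRight_mem {E F : Type*} [AddCommGroup E] [Module ℂ E]
    [FiniteDimensional ℂ E] [AddCommGroup F] [Module ℂ F] (R : Submodule ℂ (E →ₗ[ℂ] F))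
    (h : ∀ (f : Module.Dual ℂ E) (y : F), f.smulRight y ∈ R) : R = ⊤ := by
  rw [eq_top_iff]
  intro T _
  let b := Module.finBasis ℂ E
  have hT : T = ∑ i, (b.coord i).smulRight (T (b i)) := by
    refine b.ext fun j => ?_
    simp [Finsupp.single_apply]
  rw [hT]
  exact R.sum_mem fun i _ => h _ _

/-- Rank-one maps span, used twice: `End (End V)` is spanned by `φ ⊗ Y` with `φ = (X ↦ f (X v))` and
`Y = h ⊗ y`. Surjectivity of `B` turns `f` and `h` into vectors. -/
lemma tensorToEndEnd_surjective (B : V ≃ₗ[ℂ] Module.Dual ℂ V) :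
    Function.Surjective (tensorToEndEnd B.toLinearMap) := by
  rw [← LinearMap.range_eq_top]
  apply eq_top_of_smulRight_mem
  intro φ Y
  have hφ : φ ∈ Submodule.span ℂ (Set.range fun p : Module.Dual ℂ V × V =>
      (p.1 ∘ₗ LinearMap.applyₗ p.2 : Module.Dual ℂ (V →ₗ[ℂ] V))) := by
    rw [span_eval_eq_top]; trivial
  induction hφ using Submodule.span_induction with
  | mem φ h =>
    obtain ⟨⟨f, v⟩, rfl⟩ := h
    have := eq_top_of_smulRight_mem
      ((LinearMap.range (tensorToEndEnd B.toLinearMap)).comap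
        (LinearMap.smulRightₗ (f ∘ₗ LinearMap.applyₗ v : Module.Dual ℂ (V →ₗ[ℂ] V)))) (by
        intro h y
        refine ⟨PiTensorProduct.tprod ℂ ![B.symm f, v, B.symm h, y], ?_⟩
        rw [tensorToEndEnd_tprod]
        ext X w
        simp)
    have hY : Y ∈ (⊤ : Submodule ℂ (V →ₗ[ℂ] V)) := Submodule.mem_top
    rw [← this] at hY
    exact hY
  | zero =>
    convert Submodule.zero_mem _
    ext; simp
  | add φ ψ _ _ h₁ h₂ =>
    convert Submodule.add_mem _ h₁ h₂
    ext; simp [add_smul]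
  | smul c φ _ h =>
    convert Submodule.smul_mem _ c h
    ext; simp [mul_smul]

lemma tensorToEndEnd_bijective (B : V ≃ₗ[ℂ] Module.Dual ℂ V) :
    Function.Bijective (tensorToEndEnd B.toLinearMap) := by
  let b := Basis.piTensorProduct fun _ : Fin 4 => Module.finBasis ℂ V
  have : FiniteDimensional ℂ (⨂[ℂ] _ : Fin 4, V) := Module.Basis.finiteDimensional_of_finite b
  -- Both sides have dimension `(dim V)⁴`, so surjectivity suffices.
  have hdim : Module.finrank ℂ (⨂[ℂ] _ : Fin 4, V) =
      Module.finrank ℂ ((V →ₗ[ℂ] V) →ₗ[ℂ] (V →ₗ[ℂ] V)) := by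
    rw [Module.finrank_eq_card_basis b]
    simp only [Module.finrank_linearMap, Fintype.card_pi, Fintype.card_fin, Finset.prod_const,
      Finset.card_univ]
    ring
  have hs := tensorToEndEnd_surjective B
  exact ⟨(LinearMap.injective_iff_surjective_of_finrank_eq_finrank hdim).2 hs, hs⟩

/-- For a self-dual representation, the fourth moment bounds the dimension of the space of
equivariant endomorphisms of `End V`. -/
lemma IsSelfDual.finrank_invariants_le {ρ : Representation ℂ G V} (hρ : ρ.IsSelfDual) :
    Module.finrank ℂ ((ρ.linHom ρ).linHom (ρ.linHom ρ)).invariants ≤ ρ.satoTateMoment 4 := by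
  obtain ⟨B, hB⟩ := hρ.exists_form
  let Ψ := LinearEquiv.ofBijective _ (tensorToEndEnd_bijective B)
  let b := Basis.piTensorProduct fun _ : Fin 4 => Module.finBasis ℂ V
  have : FiniteDimensional ℂ (⨂[ℂ] _ : Fin 4, V) := Module.Basis.finiteDimensional_of_finite b
  have hle : ((ρ.linHom ρ).linHom (ρ.linHom ρ)).invariants ≤
      (ρ.tensorPow 4).invariants.map Ψ.toLinearMap := by
    intro T hT
    refine ⟨Ψ.symm T, fun g => ?_, Ψ.apply_symm_apply T⟩
    apply Ψ.injective
    rw [Ψ.apply_symm_apply]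
    refine (tensorToEndEnd_equivariant ρ hB g _).trans ?_
    change _ = T
    have : tensorToEndEnd B.toLinearMap (Ψ.symm T) = T := Ψ.apply_symm_apply T
    rw [this]
    exact hT g
  refine (Submodule.finrank_mono hle).trans ?_
  rw [satoTateMoment]
  exact Submodule.finrank_map_le _ _

end FourthMoment

end Representation

/-! ### Eigenvalues in compact groups and their rigidity along connected sets. -/

lemma IsPreconnected.eq_of_finite_image {X : Type*} [TopologicalSpace X] {T : Set X}
    (hT : IsPreconnected T) {h : X → ℂ} (hh : ContinuousOn h T) (hfin : (h '' T).Finite)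
    {s t : X} (hs : s ∈ T) (ht : t ∈ T) : h s = h t := by
  by_contra hne
  -- A connected set in `ℂ` with two points is infinite.
  exact ((hT.image h hh).infinite_of_nontrivial
    ⟨h s, Set.mem_image_of_mem h hs, h t, Set.mem_image_of_mem h ht, hne⟩) hfin

namespace Representation

section Compact

variable {G V : Type*} [Group G] [TopologicalSpace G] [CompactSpace G]
  [AddCommGroup V] [Module ℂ V] {ρ : Representation ℂ G V}

lemma IsContinuous.exists_norm_le (hρ : ρ.IsContinuous) (v : V) (f : Module.Dual ℂ V) :
    ∃ C, ∀ g, ‖f (ρ g v)‖ ≤ C := by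
  obtain ⟨C, hC⟩ := isCompact_univ.exists_bound_of_continuousOn (hρ v f).continuousOn
  exact ⟨C, fun g => hC g (Set.mem_univ g)⟩

lemma pow_apply_of_eigen {f : Module.End ℂ V} {v : V} {c : ℂ} (h : f v = c • v) (n : ℕ) :
    (f ^ n) v = c ^ n • v := by
  induction n with
  | zero => simp
  | succ n ih => rw [pow_succ', Module.End.mul_apply, ih, map_smul, h, smul_smul, pow_succ]

/-- The powers `c ^ n` are matrix coefficients at `g ^ n`, hence bounded by compactness. -/
lemma IsContinuous.norm_eigenvalue_le_one (hρ : ρ.IsContinuous) {g : G} {v : V} {c : ℂ}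
    (hv : v ≠ 0) (h : ρ g v = c • v) : ‖c‖ ≤ 1 := by
  obtain ⟨f, hf⟩ := Module.Projective.exists_dual_eq_one ℂ hv
  obtain ⟨C, hC⟩ := hρ.exists_norm_le v f
  by_contra! hc
  obtain ⟨n, hn⟩ := pow_unbounded_of_one_lt C hc
  have := hC (g ^ n)
  rw [map_pow, pow_apply_of_eigen h, map_smul, hf, smul_eq_mul, mul_one, norm_pow] at this
  linarith

lemma IsContinuous.norm_eigenvalue (hρ : ρ.IsContinuous) {g : G} {v : V} {c : ℂ}
    (hv : v ≠ 0) (h : ρ g v = c • v) : ‖c‖ = 1 := by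
  refine le_antisymm (hρ.norm_eigenvalue_le_one hv h) ?_
  have hc : c ≠ 0 := by
    rintro rfl
    apply hv
    have := congrArg (ρ g⁻¹) h
    simpa using this
  have h' : ρ g⁻¹ v = c⁻¹ • v := by
    have := congrArg (fun w => c⁻¹ • ρ g⁻¹ w) h
    simpa [hc] using this.symm
  have := hρ.norm_eigenvalue_le_one hv h'
  rw [norm_inv] at this
  exact (inv_le_one₀ (norm_pos_iff.2 hc)).1 this

/-- Elements of a compact group act without nontrivial Jordan blocks. -/
lemma IsContinuous.eq_zero_of_jordan (hρ : ρ.IsContinuous) {g : G} {u w : V} {c : ℂ}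
    (hw : ρ g w = c • w) (hu : ρ g u = c • u + w) : w = 0 := by
  by_contra hne
  have hc := hρ.norm_eigenvalue hne hw
  obtain ⟨f, hf⟩ := Module.Projective.exists_dual_eq_one ℂ hne
  obtain ⟨C, hC⟩ := hρ.exists_norm_le u f
  -- A Jordan block makes the coefficients of `g ^ n` grow linearly in `n`. The extra factor `c`
  -- avoids the exponent `n - 1`.
  have key (n : ℕ) : c • (ρ g ^ n) u = (c ^ (n + 1)) • u + ((n : ℂ) * c ^ n) • w := by
    induction n with
    | zero => simp
    | succ n ih =>
      rw [pow_succ', Module.End.mul_apply, ← map_smul, ih, map_add, map_smul, map_smul, hu, hw]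
      push_cast
      module
  obtain ⟨n, hn⟩ := exists_nat_gt (C + ‖f u‖)
  have h1 := congrArg f (key n)
  rw [← map_pow, map_add, map_smul, map_smul, map_smul, hf] at h1
  have h2 : (n : ℂ) * c ^ n = c * f (ρ (g ^ n) u) - c ^ (n + 1) * f u := by
    simp only [smul_eq_mul, mul_one] at h1
    rw [h1]; ring
  have h3 : (n : ℝ) ≤ ‖f (ρ (g ^ n) u)‖ + ‖f u‖ := by
    calc (n : ℝ) = ‖(n : ℂ) * c ^ n‖ := by simp [hc]
      _ ≤ ‖c * f (ρ (g ^ n) u)‖ + ‖c ^ (n + 1) * f u‖ := by rw [h2]; exact norm_sub_le _ _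
      _ = _ := by simp [hc]
  linarith [hC (g ^ n)]

lemma IsContinuous.maxGenEigenspace_eq (hρ : ρ.IsContinuous) (g : G) (c : ℂ) :
    Module.End.maxGenEigenspace (ρ g) c = Module.End.eigenspace (ρ g) c := by
  refine le_antisymm ?_ ((Module.End.genEigenspace (ρ g) c).monotone le_top)
  intro v hv
  rw [Module.End.mem_maxGenEigenspace] at hv
  obtain ⟨k, hk⟩ := hv
  rw [Module.End.mem_eigenspace_iff]
  induction k with
  | zero => simp_all
  | succ k ih =>
    cases k with
    | zero => simpa [sub_eq_zero] using hk
    | succ k =>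
      apply ih
      -- If `(ρ g - c) ^ (k + 2)` kills `v`, then `u` and `(ρ g - c) u` form a Jordan block, so the
      -- latter vanishes and the exponent drops by one.
      set u := ((ρ g - c • (1 : Module.End ℂ V)) ^ k) v with hu
      have hw : (ρ g - c • (1 : Module.End ℂ V)) ((ρ g - c • (1 : Module.End ℂ V)) u) = 0 := by
        rw [hu, ← Module.End.mul_apply, ← Module.End.mul_apply, mul_assoc, ← pow_succ', ← pow_succ']
        exact hk
      rw [pow_succ', Module.End.mul_apply]
      refine hρ.eq_zero_of_jordan (g := g) (u := u) (c := c) ?_ ?_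
      · simpa [sub_eq_zero] using hw
      · simp [← hu]

variable [FiniteDimensional ℂ V]

/-- Pairwise commuting elements of a compact group are simultaneously diagonalizable. -/
lemma IsContinuous.iSup_iInf_eigenspace_eq_top (hρ : ρ.IsContinuous) {ι : Type*} (γ : ι → G)
    (h : ∀ i j, Commute (γ i) (γ j)) :
    ⨆ χ : ι → ℂ, ⨅ i, Module.End.eigenspace (ρ (γ i)) (χ i) = ⊤ := by
  have := Module.End.iSup_iInf_maxGenEigenspace_eq_top_of_iSup_maxGenEigenspace_eq_top_of_commute
    (fun i => ρ (γ i)) (fun i j _ => (h i j).map ρ)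
    (fun i => Module.End.iSup_maxGenEigenspace_eq_top _)
  simpa only [hρ.maxGenEigenspace_eq] using this

/-- To prove that two endomorphisms agree, check on common eigenvectors of a commuting family. -/
lemma IsContinuous.ext_of_joint_eigenvectors (hρ : ρ.IsContinuous) {ι : Type*} (γ : ι → G)
    (h : ∀ i j, Commute (γ i) (γ j)) {X Y : Module.End ℂ V}
    (hXY : ∀ (χ : ι → ℂ) (v : V), v ≠ 0 → (∀ i, ρ (γ i) v = χ i • v) → X v = Y v) : X = Y := by
  have hle : (⊤ : Submodule ℂ V) ≤ LinearMap.eqLocus X Y := by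
    rw [← hρ.iSup_iInf_eigenspace_eq_top γ h]
    refine iSup_le fun χ v hv => ?_
    by_cases h0 : v = 0
    · simp [h0]
    · refine hXY χ v h0 fun i => ?_
      rw [Submodule.mem_iInf] at hv
      exact Module.End.mem_eigenspace_iff.1 (hv i)
  ext v
  exact hle (Submodule.mem_top (x := v))

variable [IsTopologicalGroup G]

/-- If the conjugates of `m` under a connected subgroup commute with one another, then the
subgroup centralizes `m`. -/
lemma IsContinuous.conj_eq_of_commute_conj (hρ : ρ.IsContinuous)
    (hinj : Function.Injective ρ) {H : Subgroup G} (hH : IsPreconnected (H : Set G)) (m : G)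
    (hcomm : ∀ s ∈ H, ∀ t ∈ H, Commute (s * m * s⁻¹) (t * m * t⁻¹)) {t : G} (ht : t ∈ H) :
    t * m * t⁻¹ = m := by
  apply hinj
  refine hρ.ext_of_joint_eigenvectors (fun s : H => (s : G) * m * (s : G)⁻¹)
    (fun s t => hcomm s s.2 t t.2) fun χ v hv hχ => ?_
  obtain ⟨f, hf⟩ := Module.Projective.exists_dual_eq_one ℂ hv
  have hval (s : H) : f (ρ (s * m * (s : G)⁻¹) v) = χ s := by rw [hχ s, map_smul, hf, smul_eq_mul, mul_one]
  have hcont : Continuous fun s : G => f (ρ (s * m * s⁻¹) v) := (hρ v f).comp (by fun_prop)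
  -- On a common eigenvector `v`, the eigenvalue of `s * m * s⁻¹` is also an eigenvalue of `m`, with
  -- eigenvector `ρ s⁻¹ v`. It takes finitely many values and is continuous in `s`, hence constant
  -- on `H`.
  have hfin : ((fun s : G => f (ρ (s * m * s⁻¹) v)) '' H).Finite := by
    refine (Module.End.finite_hasEigenvalue (ρ m)).subset ?_
    rintro _ ⟨s, hs, rfl⟩
    change Module.End.HasEigenvalue (ρ m) (f (ρ (s * m * s⁻¹) v))
    rw [hval ⟨s, hs⟩]
    refine Module.End.hasEigenvalue_of_hasEigenvector (x := ρ s⁻¹ v) ⟨?_, ?_⟩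
    · rw [Module.End.mem_eigenspace_iff, ← map_smul, ← hχ ⟨s, hs⟩, ← Module.End.mul_apply,
        ← Module.End.mul_apply, ← map_mul, ← map_mul]
      congr 2
      simp [mul_assoc]
    · intro h
      apply hv
      simpa using congrArg (ρ s) h
  have h1 := hH.eq_of_finite_image hcont.continuousOn hfin ht H.one_mem
  have h2 := hχ ⟨t, ht⟩
  have h3 := hχ 1
  have h4 := hval ⟨t, ht⟩
  have h5 := hval 1
  simp only [OneMemClass.coe_one, one_mul, inv_one, mul_one] at h1 h2 h3 h4 h5
  rw [h2, h3, ← h4, ← h5, h1]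

end Compact

end Representation

/-! ### Connectedness of generated and commutator subgroups. -/

section ConnectedSubgroups

open scoped commutatorElement

variable {G : Type*} [Group G] [TopologicalSpace G] [IsTopologicalGroup G]

/-- Each word in the generators is joined to `1` inside the subgroup by chaining translates and
inverses of connected sets. -/
lemma Subgroup.isPreconnected_closure {S : Set G} (hS : IsPreconnected S) (h1 : (1 : G) ∈ S) :
    IsPreconnected (Subgroup.closure S : Set G) := by
  refine isPreconnected_of_forall 1 fun x hx => ?_
  induction hx using Subgroup.closure_induction with
  | mem x hx => exact ⟨S, Subgroup.subset_closure, h1, hx, hS⟩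
  | one => exact ⟨{1}, by simp, rfl, rfl, isPreconnected_singleton⟩
  | mul x y hx hy ihx ihy =>
    obtain ⟨t, ht, h1t, hxt, hpt⟩ := ihx
    obtain ⟨u, hu, h1u, hyu, hpu⟩ := ihy
    refine ⟨t ∪ (fun z => x * z) '' u, ?_, Or.inl h1t, Or.inr ⟨y, hyu, rfl⟩, ?_⟩
    · rintro z (hz | ⟨z, hz, rfl⟩)
      · exact ht hz
      · exact Subgroup.mul_mem _ hx (hu hz)
    · exact hpt.union x hxt ⟨1, h1u, mul_one x⟩
        (hpu.image _ (continuous_const_mul x).continuousOn)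
  | inv x hx ihx =>
    obtain ⟨t, ht, h1t, hxt, hpt⟩ := ihx
    refine ⟨Inv.inv '' t, ?_, ⟨1, h1t, inv_one⟩, ⟨x, hxt, rfl⟩,
      hpt.image _ continuous_inv.continuousOn⟩
    rintro _ ⟨z, hz, rfl⟩
    exact Subgroup.inv_mem _ (ht hz)

lemma Subgroup.isPreconnected_commutator {H : Subgroup G} (hH : IsPreconnected (H : Set G)) :
    IsPreconnected ((⁅H, H⁆ : Subgroup G) : Set G) := by
  have hS : {g : G | ∃ a ∈ H, ∃ b ∈ H, ⁅a, b⁆ = g} =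
      (fun p : G × G => ⁅p.1, p.2⁆) '' ((H : Set G) ×ˢ (H : Set G)) := by
    ext g
    constructor
    · rintro ⟨a, ha, b, hb, rfl⟩
      exact ⟨(a, b), ⟨ha, hb⟩, rfl⟩
    · rintro ⟨⟨a, b⟩, ⟨ha, hb⟩, rfl⟩
      exact ⟨a, ha, b, hb, rfl⟩
  rw [Subgroup.commutator_def]
  refine Subgroup.isPreconnected_closure ?_ ⟨1, H.one_mem, 1, H.one_mem, by simp⟩
  rw [hS]
  refine (hH.prod hH).image _ (Continuous.continuousOn ?_)
  simp only [commutatorElement_def]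
  fun_prop

instance Subgroup.connectedComponentOfOne_normal :
    (Subgroup.connectedComponentOfOne G).Normal where
  conj_mem n hn g := by
    have hc : Continuous fun x : G => g * x * g⁻¹ := by fun_prop
    have := hc.image_connectedComponent_subset 1 (Set.mem_image_of_mem _ hn)
    simp only [mul_one, mul_inv_cancel] at this
    exact this

end ConnectedSubgroups

namespace Representation

/-! ### Connected solvable subgroups and semisimplicity. -/

section Compact

variable {G V : Type*} [Group G] [TopologicalSpace G] [CompactSpace G] [IsTopologicalGroup G]
  [AddCommGroup V] [Module ℂ V] [FiniteDimensional ℂ V] {ρ : Representation ℂ G V}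

/-- Rigidity is applied twice. Conjugates of `m ∈ ⁅H, H⁆` lie in the commutative group `⁅H, H⁆`, so
`⁅H, H⁆` is central in `H`. Then conjugates of any `m ∈ H` differ from `m` by central factors, so
they commute with one another and `m` is central too. -/
lemma IsContinuous.commute_of_commute_commutator (hρ : ρ.IsContinuous)
    (hinj : Function.Injective ρ) {H : Subgroup G} (hH : IsPreconnected (H : Set G))
    (hcomm : ∀ x ∈ ⁅H, H⁆, ∀ y ∈ ⁅H, H⁆, Commute x y) :
    ∀ x ∈ H, ∀ y ∈ H, Commute x y := by
  have hmem {s m : G} (hs : s ∈ H) (hm : m ∈ H) : s * m * s⁻¹ * m⁻¹ ∈ ⁅H, H⁆ :=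
    Subgroup.commutator_mem_commutator hs hm
  have hle : ⁅H, H⁆ ≤ H := Subgroup.commutator_le_self H
  have hconj {s m : G} (hs : s ∈ H) (hm : m ∈ ⁅H, H⁆) : s * m * s⁻¹ ∈ ⁅H, H⁆ := by
    have := Subgroup.mul_mem _ (hmem hs (hle hm)) hm
    simpa using this
  have hcent {m t : G} (hm : m ∈ ⁅H, H⁆) (ht : t ∈ H) : Commute t m := by
    have := hρ.conj_eq_of_commute_conj hinj hH m
      (fun s hs t ht => hcomm _ (hconj hs hm) _ (hconj ht hm)) ht
    exact mul_inv_eq_iff_eq_mul.1 this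
  intro x hx m hm
  refine mul_inv_eq_iff_eq_mul.1 (hρ.conj_eq_of_commute_conj hinj hH m (fun s hs t ht => ?_) hx)
  have hsm : Commute (s * m * s⁻¹) m := by
    have h : Commute (s * m * s⁻¹ * m⁻¹) m := (hcent (hmem hs hm) hm).symm
    simpa using h.mul_left (Commute.refl m)
  have h : Commute (s * m * s⁻¹) (t * m * t⁻¹ * m⁻¹) :=
    hcent (hmem ht hm) (H.mul_mem (H.mul_mem hs hm) (H.inv_mem hs))
  simpa using h.mul_right hsm

/-- A connected solvable subgroup of a compact linear group is commutative. -/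
lemma IsContinuous.commute_of_isSolvable (hρ : ρ.IsContinuous)
    (hinj : Function.Injective ρ) {H : Subgroup G} (hH : IsPreconnected (H : Set G))
    (hsol : Group.IsSolvable H) : ∀ x ∈ H, ∀ y ∈ H, Commute x y := by
  let D : ℕ → Subgroup G := fun k => (derivedSeries H k).map H.subtype
  have hD0 : D 0 = H := by simp [D, ← MonoidHom.range_eq_map]
  have hDsucc (k : ℕ) : D (k + 1) = ⁅D k, D k⁆ := by
    simp only [D, derivedSeries_succ, Subgroup.map_commutator]
  have hDconn (k : ℕ) : IsPreconnected (D k : Set G) := by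
    induction k with
    | zero => rwa [hD0]
    | succ k ih => rw [hDsucc]; exact Subgroup.isPreconnected_commutator ih
  obtain ⟨n, hn⟩ := hsol.solvable
  have hDn : ∀ x ∈ D n, ∀ y ∈ D n, Commute x y := by
    intro x hx y _
    have : x = 1 := by simpa [D, hn] using hx
    rw [this]
    exact Commute.one_left y
  -- Commutativity climbs the derived series from the trivial term `D n` back to `D 0 = H`.
  suffices h : ∀ x ∈ D 0, ∀ y ∈ D 0, Commute x y by rwa [hD0] at h
  clear hn
  induction n with
  | zero => exact hDn
  | succ n ih =>
    apply ih
    rw [hDsucc] at hDn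
    exact hρ.commute_of_commute_commutator hinj (hDconn n) hDn

/-- A compact connected linear group preserving a nondegenerate bilinear form is semisimple as
soon as its center consists of scalars. -/
lemma IsContinuous.isSemisimpleGroup [ConnectedSpace G] (hρ : ρ.IsContinuous)
    (hinj : Function.Injective ρ) (B : V ≃ₗ[ℂ] Module.Dual ℂ V)
    (hB : ∀ g v w, B (ρ g v) w = B v (ρ g⁻¹ w))
    (hZ : ∀ z : G, (∀ k, Commute z k) → ∃ c : ℂ, ρ z = c • 1) : IsSemisimpleGroup G := by
  refine ⟨inferInstance, fun N hN hsol hconn => ?_⟩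
  have hNcomm := hρ.commute_of_isSolvable hinj hconn.isPreconnected hsol
  -- Conjugates of `z ∈ N` stay in the commutative group `N`; rigidity under the whole connected
  -- group makes `z` central.
  have hNcent : ∀ z ∈ N, ∀ k, Commute z k := by
    intro z hz k
    have := hρ.conj_eq_of_commute_conj hinj (H := ⊤) (by simpa using isPreconnected_univ) z
      (fun s _ t _ => hNcomm _ (hN.conj_mem z hz s) _ (hN.conj_mem z hz t)) (t := k) (Subgroup.mem_top k)
    exact (mul_inv_eq_iff_eq_mul.1 this).symm
  rw [Subgroup.eq_bot_iff_forall]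
  intro z hz
  apply hinj
  rw [map_one]
  ext v
  rw [Module.End.one_apply]
  by_cases hv : v = 0
  · simp [hv]
  obtain ⟨f, hf⟩ := Module.Projective.exists_dual_eq_one ℂ hv
  -- On `N` the action is by scalars `c`, and invariance of `B` gives `c ^ 2 = 1`. Connectedness of
  -- `N` then pins `c` to its value `1` at the identity.
  have hfin : ((fun g => f (ρ g v)) '' (N : Set G)).Finite := by
    refine (Set.toFinite {1, -1}).subset ?_
    rintro _ ⟨n, hn, rfl⟩
    obtain ⟨c, hc⟩ := hZ n (hNcent n hn)
    have hBv : B v ≠ 0 := by simpa using hv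
    obtain ⟨w, hw⟩ : ∃ w, B v w ≠ 0 := by
      by_contra! h
      exact hBv (LinearMap.ext h)
    have h1 := hB n v (ρ n w)
    rw [hc] at h1
    have h2 : ρ n⁻¹ (c • w) = w := by
      have : ρ n⁻¹ (ρ n w) = w := by simp
      simpa [hc] using this
    simp only [LinearMap.smul_apply, Module.End.one_apply, h2] at h1
    have hc2 : c ^ 2 = 1 := by
      have h3 : (c ^ 2 - 1) * B v w = 0 := by
        simp only [map_smul, LinearMap.smul_apply, smul_eq_mul] at h1
        linear_combination h1
      exact sub_eq_zero.1 ((mul_eq_zero.1 h3).resolve_right hw)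
    have hval : f (ρ n v) = c := by simp [hc, hf]
    simp only [hval]
    exact sq_eq_one_iff.1 hc2
  have h1 := hconn.isPreconnected.eq_of_finite_image (hρ v f).continuousOn hfin hz N.one_mem
  obtain ⟨c, hc⟩ := hZ z (hNcent z hz)
  have hc1 : c = 1 := by simpa [hc, hf] using h1
  simp [hc, hc1]

end Compact

end Representation

/-! ### Recognizing tori through characters. -/

section Torus

open MeasureTheory UnitAddTorus

/-- Finite measures on the torus are determined by their Fourier coefficients. -/
lemma UnitAddTorus.measure_ext_of_integral_mFourier {d : Type*} [Fintype d]
    {μ ν : Measure (UnitAddTorus d)} [IsFiniteMeasure μ] [IsFiniteMeasure ν]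
    (h : ∀ n, ∫ x, mFourier n x ∂μ = ∫ x, mFourier n x ∂ν) : μ = ν := by
  have hint (f : C(UnitAddTorus d, ℂ)) (P : Measure (UnitAddTorus d)) [IsFiniteMeasure P] :
      Integrable f P :=
    f.continuous.integrable_of_hasCompactSupport (HasCompactSupport.of_compactSpace _)
  refine ext_of_forall_mem_subalgebra_integral_eq_of_polish (𝕜 := ℂ)
    (A := (mFourierSubalgebra d).comap (BoundedContinuousFunction.toContinuousMapStarₐ ℂ)) ?_ ?_
  · intro x y hxy
    obtain ⟨_, ⟨f, hf, rfl⟩, hfxy⟩ := mFourierSubalgebra_separatesPoints hxy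
    exact ⟨_, ⟨f, ⟨BoundedContinuousFunction.mkOfCompact f, hf, by ext; rfl⟩, rfl⟩, hfxy⟩
  · intro g hg
    have hg' : (g : C(UnitAddTorus d, ℂ)) ∈ Submodule.span ℂ (Set.range (mFourier (d := d))) := by
      rw [← mFourierSubalgebra_coe]; exact hg
    suffices H : ∀ f ∈ Submodule.span ℂ (Set.range (mFourier (d := d))),
        ∫ x, f x ∂μ = ∫ x, f x ∂ν from H _ hg'
    intro f hf
    induction hf using Submodule.span_induction with
    | mem f hf => obtain ⟨n, rfl⟩ := hf; exact h n
    | zero => simp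
    | add f g _ _ hf hg =>
      simp only [ContinuousMap.add_apply]
      rw [integral_add (hint f _) (hint g _), integral_add (hint f _) (hint g _), hf, hg]
    | smul c f _ hf => simp [integral_const_mul, hf]

variable {K : Type*} [Group K] [TopologicalSpace K] [IsTopologicalGroup K] [CompactSpace K]

/-- A compact group mapping to a torus surjects onto it if no nontrivial character of the torus
vanishes on the image. -/
lemma UnitAddTorus.surjective_of_mFourier {d : Type*} [Fintype d] {Φ : K → UnitAddTorus d}
    (hΦ : Continuous Φ) (hmul : ∀ x y, Φ (x * y) = Φ x + Φ y)
    (hn : ∀ n : d → ℤ, (∀ k, mFourier n (Φ k) = 1) → n = 0) : Function.Surjective Φ := by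
  let : MeasurableSpace K := borel K
  have : BorelSpace K := ⟨rfl⟩
  let μ : Measure K := Measure.haarMeasure ⊤
  have : IsProbabilityMeasure μ := ⟨Measure.haarMeasure_self⟩
  have hadd (n : d → ℤ) (x y : UnitAddTorus d) :
      mFourier n (x + y) = mFourier n x * mFourier n y := by
    simp [mFourier, Finset.prod_mul_distrib, fourier_apply, smul_add,
      AddCircle.toCircle_add]
  -- Haar measure pushes forward to Haar measure: for `n ≠ 0`, translating by some `k` with
  -- `mFourier n (Φ k) ≠ 1` shows that both `n`-th coefficients vanish.
  have hpush : μ.map Φ = volume := by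
    have : IsProbabilityMeasure (μ.map Φ) := Measure.isProbabilityMeasure_map hΦ.aemeasurable
    refine UnitAddTorus.measure_ext_of_integral_mFourier fun n => ?_
    rw [integral_map hΦ.aemeasurable (mFourier n).continuous.aestronglyMeasurable]
    by_cases h0 : n = 0
    · simp [h0, mFourier_zero, Measure.real, volume_pi, Measure.pi_univ]
    · have : ∃ k, mFourier n (Φ k) ≠ 1 := by
        by_contra! h
        exact h0 (hn n h)
      obtain ⟨k, hk⟩ := this
      have aux {a I : ℂ} (ha : a ≠ 1) (h : a * I = I) : I = 0 := by
        have : (a - 1) * I = 0 := by rw [sub_mul, h, one_mul, sub_self]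
        exact (mul_eq_zero.1 this).resolve_left (sub_ne_zero.2 ha)
      rw [aux hk (I := ∫ x, mFourier n (Φ x) ∂μ), aux hk (I := ∫ x, mFourier n x)]
      · rw [← integral_const_mul, ← integral_add_left_eq_self (fun x => mFourier n x) (Φ k)]
        simp [hadd]
      · rw [← integral_const_mul,
          ← integral_mul_left_eq_self (μ := μ) (fun x => mFourier n (Φ x)) k]
        simp [hmul, hadd]
  have hclosed : IsClosed (Set.range Φ) := (isCompact_range hΦ).isClosed
  -- The complement of the compact image is open and null, hence empty.
  have hzero : volume (Set.range Φ)ᶜ = 0 := by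
    rw [← hpush, Measure.map_apply hΦ.measurable hclosed.measurableSet.compl]
    have : Φ ⁻¹' (Set.range Φ)ᶜ = ∅ := by ext; simp
    simp [this]
  have hempty := (hclosed.isOpen_compl.measure_eq_zero_iff volume).1 hzero
  rw [← Set.range_eq_univ]
  exact Set.compl_empty_iff.1 hempty

/-- A compact connected group with finitely many continuous characters separating its points is a
torus. -/
theorem isTorusGroup_of_separating_characters [ConnectedSpace K] {S : Set (K →ₜ* Circle)}
    (hS : S.Finite) (hsep : ∀ k, (∀ χ ∈ S, χ k = 1) → k = 1) : IsTorusGroup K := by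
  -- The character group generated by `S` is finitely generated, and torsion-free by connectedness
  -- of `K`, hence free; a basis gives the coordinates of the torus.
  let X := Subgroup.closure S
  let A := Additive X
  have hfg : AddGroup.FG A := by
    have : Finite S := hS
    have : Group.FG X := Group.closure_finite_fg S
    infer_instance
  have hfin : Module.Finite ℤ A := Module.Finite.iff_addGroup_fg.2 hfg
  let ev (k : K) : A →+ Additive Circle :=
    MonoidHom.toAdditive
      { toFun := fun χ : X => (χ : K →ₜ* Circle) k
        map_one' := rfl
        map_mul' := fun _ _ => rfl }
  have hev (a : A) (h : ∀ k, ev k a = 0) : a = 0 := by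
    apply Additive.toMul.injective
    apply Subtype.ext
    exact ContinuousMonoidHom.ext h
  have htf : Module.IsTorsionFree ℤ A := by
    refine Module.IsTorsionFree.of_smul_eq_zero fun n a hna => or_iff_not_imp_left.2 fun hn => ?_
    refine hev a fun k => ?_
    -- A torsion character takes values in a finite set of roots of unity, so it is constant on the
    -- connected group `K`.
    have hpow (k : K) : ((ev k a).toMul : ℂ) ^ n.natAbs = 1 := by
      have h : (ev k a).toMul ^ n.natAbs = 1 := by
        rw [pow_natAbs_eq_one]
        have : n • ev k a = 0 := by rw [← map_zsmul, hna, map_zero]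
        exact this
      rw [← Circle.coe_pow, h, Circle.coe_one]
    have hcont : Continuous fun k => ((ev k a).toMul : ℂ) :=
      (show Continuous ((↑) : Circle → ℂ) by fun_prop).comp (map_continuous (a.toMul : K →ₜ* Circle))
    have hfinite : ((fun k => ((ev k a).toMul : ℂ)) '' Set.univ).Finite := by
      refine (Polynomial.nthRoots n.natAbs (1 : ℂ)).toFinset.finite_toSet.subset ?_
      rintro _ ⟨k, -, rfl⟩
      simpa [Polynomial.mem_nthRoots (Int.natAbs_pos.2 hn)] using hpow k
    have := isPreconnected_univ.eq_of_finite_image hcont.continuousOn hfinite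
      (Set.mem_univ k) (Set.mem_univ 1)
    have h1 : ev 1 a = 0 := map_one (a.toMul : K →ₜ* Circle)
    rw [← h1]
    exact Additive.toMul.injective (Circle.ext this)
  obtain ⟨m, b⟩ := Module.basisOfFiniteTypeTorsionFree' (R := ℤ) (M := A)
  let ψ (i : Fin m) : K →ₜ* Circle := ((b i).toMul : X)
  let Φ : K → UnitAddTorus (Fin m) :=
    fun k i => (AddCircle.homeomorphCircle one_ne_zero).symm (ψ i k)
  have hΦψ (k : K) (i : Fin m) : AddCircle.toCircle (Φ k i) = ψ i k := by
    rw [← AddCircle.homeomorphCircle_apply one_ne_zero]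
    exact Homeomorph.apply_symm_apply _ _
  have hΦ : Continuous Φ := by
    refine continuous_pi fun i => ?_
    exact (AddCircle.homeomorphCircle one_ne_zero).symm.continuous.comp (map_continuous (ψ i))
  have hmul (x y : K) : Φ (x * y) = Φ x + Φ y := by
    ext1 i
    apply AddCircle.injective_toCircle one_ne_zero
    rw [Pi.add_apply, AddCircle.toCircle_add, hΦψ, hΦψ, hΦψ, map_mul]
  have hF (n : Fin m → ℤ) (k : K) :
      mFourier n (Φ k) = ((ev k (∑ i, n i • b i)).toMul : Circle) := by
    have h : (ev k (∑ i, n i • b i)).toMul = ∏ i, ψ i k ^ n i := by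
      rw [map_sum, toMul_sum]
      refine Finset.prod_congr rfl fun i _ => ?_
      rw [map_zsmul, toMul_zsmul]
      rfl
    rw [h]
    simp only [mFourier, ContinuousMap.coe_mk, fourier_apply, AddCircle.toCircle_zsmul, hΦψ]
    exact (map_prod Circle.coeHom (fun i => ψ i k ^ n i) Finset.univ).symm
  have hsurj : Function.Surjective Φ := by
    refine UnitAddTorus.surjective_of_mFourier hΦ hmul fun n hn => ?_
    have h0 : ∑ i, n i • b i = 0 := by
      refine hev _ fun k => ?_
      have := hn k
      rw [hF] at this
      exact Additive.toMul.injective (Circle.ext this)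
    exact funext (Fintype.linearIndependent_iff.1 b.linearIndependent n h0)
  -- This is `Φ` read in the multiplicative circle. Its kernel is trivial because every character in
  -- `S` is a combination of the basis characters.
  let Θ : K → (Fin m → Circle) := fun k i => ψ i k
  have hΘ : Continuous Θ := continuous_pi fun i => map_continuous (ψ i)
  have hΘmul (x y : K) : Θ (x * y) = Θ x * Θ y := by
    ext1 i; exact map_mul (ψ i) x y
  have hΘsurj : Function.Surjective Θ := by
    intro t
    obtain ⟨k, hk⟩ := hsurj fun i => (AddCircle.homeomorphCircle one_ne_zero).symm (t i)
    refine ⟨k, funext fun i => ?_⟩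
    exact (AddCircle.homeomorphCircle one_ne_zero).symm.injective (congrFun hk i)
  have hker (k : K) (hk : Θ k = 1) : k = 1 := by
    refine hsep k fun χ hχ => ?_
    let a : A := Additive.ofMul ⟨χ, Subgroup.subset_closure hχ⟩
    have hb (i : Fin m) : ev k (b i) = 0 := congrArg Additive.ofMul (congrFun hk i)
    have : ev k a = 0 := by
      rw [← b.sum_repr a, map_sum]
      exact Finset.sum_eq_zero fun i _ => by rw [map_zsmul, hb, smul_zero]
    exact this
  have hΘinj : Function.Injective Θ :=
    (injective_iff_map_eq_one (MonoidHom.mk' Θ hΘmul)).2 hker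
  let e : K ≃ (Fin m → Circle) := Equiv.ofBijective Θ ⟨hΘinj, hΘsurj⟩
  have he : Continuous e := hΘ
  exact ⟨m, ⟨ContinuousMulEquiv.mk' (he.homeoOfEquivCompactToT2) hΘmul⟩⟩

end Torus

namespace Representation

/-! ### Compact connected commutative linear groups. -/

section Abelian

variable {G V : Type*} [Group G] [TopologicalSpace G] [CompactSpace G]
  [AddCommGroup V] [Module ℂ V] {ρ : Representation ℂ G V}

/-- The character by which a group acts on a common eigenvector. -/
lemma IsContinuous.exists_character (hρ : ρ.IsContinuous) {χ : G → ℂ} {v : V} (hv : v ≠ 0)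
    (h : ∀ g, ρ g v = χ g • v) : ∃ ψ : G →ₜ* Circle, ∀ g, (ψ g : ℂ) = χ g := by
  obtain ⟨f, hf⟩ := Module.Projective.exists_dual_eq_one ℂ hv
  have hval (g : G) : f (ρ g v) = χ g := by simp [h, hf]
  have hcont : Continuous χ := by simpa only [hval] using hρ v f
  have hmul (g g' : G) : χ (g * g') = χ g * χ g' := by
    rw [← hval (g * g'), map_mul, Module.End.mul_apply, h g', map_smul, map_smul, hval,
      smul_eq_mul, mul_comm]
  have hone : χ 1 = 1 := by rw [← hval, map_one, Module.End.one_apply, hf]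
  have hnorm (g : G) : χ g ∈ Submonoid.unitSphere ℂ :=
    mem_sphere_zero_iff_norm.2 (hρ.norm_eigenvalue hv (h g))
  refine ⟨⟨⟨⟨fun g => (⟨χ g, hnorm g⟩ : Circle), ?_⟩, ?_⟩, ?_⟩, fun g => rfl⟩
  · exact Circle.ext hone
  · exact fun g g' => Circle.ext (hmul g g')
  · exact hcont.subtype_mk _

variable [FiniteDimensional ℂ V]

/-- Distinct characters lie in independent joint generalized eigenspaces, of which only finitely
many are nonzero in finite dimension. -/
lemma finite_characters {G V : Type*} [Group G] [TopologicalSpace G] [AddCommGroup V] [Module ℂ V]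
    [FiniteDimensional ℂ V] {ρ : Representation ℂ G V} (hcomm : ∀ x y : G, Commute x y) :
    {ψ : G →ₜ* Circle | ∃ v : V, v ≠ 0 ∧ ∀ g, ρ g v = (ψ g : ℂ) • v}.Finite := by
  have hind := Module.End.independent_iInf_maxGenEigenspace_of_forall_mapsTo (fun g => ρ g)
    (fun g g' => Module.End.mapsTo_maxGenEigenspace_of_comm ((hcomm g' g).map ρ))
  have hfin := WellFoundedGT.finite_ne_bot_of_iSupIndep hind
  refine Set.Finite.of_finite_image (f := fun (ψ : G →ₜ* Circle) g => (ψ g : ℂ))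
    (hfin.subset ?_) ?_
  · rintro _ ⟨ψ, ⟨v, hv, h⟩, rfl⟩ hbot
    apply hv
    rw [← Submodule.mem_bot ℂ, ← hbot, Submodule.mem_iInf]
    intro g
    exact (Module.End.genEigenspace (ρ g) _).monotone le_top (Module.End.mem_eigenspace_iff.2 (h g))
  · intro ψ _ ψ' _ h
    exact ContinuousMonoidHom.ext fun g => Circle.ext (congrFun h g)

/-- A compact connected commutative linear group is a torus. -/
theorem IsContinuous.isTorusGroup [IsTopologicalGroup G] [ConnectedSpace G]
    (hρ : ρ.IsContinuous) (hinj : Function.Injective ρ) (hcomm : ∀ x y : G, Commute x y) :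
    IsTorusGroup G := by
  refine isTorusGroup_of_separating_characters (finite_characters (ρ := ρ) hcomm) fun k hk => ?_
  apply hinj
  refine hρ.ext_of_joint_eigenvectors id hcomm fun χ v hv hχ => ?_
  obtain ⟨ψ, hψ⟩ := hρ.exists_character hv hχ
  have h := hk ψ ⟨v, hv, fun g => by rw [hψ]; exact hχ g⟩
  have hχk : χ k = 1 := by rw [← hψ, h, Circle.coe_one]
  have := hχ k
  rw [hχk, one_smul] at this
  simpa using this

end Abelian

/-! ### The dichotomy for normal subgroups and the main theorem. -/

section Main

variable {G V : Type*} [Group G] [TopologicalSpace G] [IsTopologicalGroup G] [CompactSpace G]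
  [AddCommGroup V] [Module ℂ V] [FiniteDimensional ℂ V] {ρ : Representation ℂ G V}

lemma linHom_mem_span_image {G V : Type*} [Group G] [AddCommGroup V] [Module ℂ V]
    (ρ : Representation ℂ G V) (H : Subgroup G) [hH : H.Normal] (g : G) {X : V →ₗ[ℂ] V}
    (hX : X ∈ Submodule.span ℂ (ρ '' H)) :
    ρ.linHom ρ g X ∈ Submodule.span ℂ (ρ '' H) := by
  have hle : Submodule.span ℂ (ρ '' H) ≤
      (Submodule.span ℂ (ρ '' H)).comap (ρ.linHom ρ g) := by
    rw [Submodule.span_le]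
    rintro _ ⟨h, hh, rfl⟩
    refine Submodule.subset_span ⟨g * h * g⁻¹, hH.conj_mem h hh g, ?_⟩
    simp only [map_mul, linHom_apply]
    rfl
  exact hle hX

lemma commute_of_mem_span {R : Type*} [Ring R] [Algebra ℂ R] {s : Set R} {y x : R}
    (hx : x ∈ Submodule.span ℂ s) (h : ∀ a ∈ s, Commute a y) : Commute x y := by
  induction hx using Submodule.span_induction with
  | mem a ha => exact h a ha
  | zero => exact Commute.zero_left y
  | add a b _ _ ha hb => exact ha.add_left hb
  | smul c a _ ha => exact ha.smul_left c

/-- If the fourth moment of a faithful self-dual representation is at most three, then a normal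
subgroup is commutative or has only scalars in its center. -/
lemma IsContinuous.commute_or_center_scalar (hρ : ρ.IsContinuous)
    (hinj : Function.Injective ρ) (hdual : ρ.IsSelfDual) (ha : ρ.satoTateMoment 4 ≤ 3)
    (K : Subgroup G) [hK : K.Normal] :
    (∀ x ∈ K, ∀ y ∈ K, Commute x y) ∨
      ∀ z ∈ K, (∀ k ∈ K, Commute z k) → ∃ c : ℂ, ρ z = c • 1 := by
  by_contra! hcon
  obtain ⟨⟨x₀, hx₀, y₀, hy₀, hxy⟩, z₀, hz₀, hz₀c, hz₀s⟩ := hcon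
  -- The center of `K`, written inside `G` so that its normality in `G` is automatic.
  let Z : Subgroup G := K ⊓ Subgroup.centralizer K
  have hZmem {z : G} : z ∈ Z ↔ z ∈ K ∧ ∀ k ∈ K, Commute z k := by
    simp only [Z, Subgroup.mem_inf, Subgroup.mem_centralizer_iff]
    exact and_congr_right fun _ => forall₂_congr fun _ _ => eq_comm
  have hZ : Z.Normal := inferInstance
  let W₁ : Submodule ℂ (Module.End ℂ V) := Submodule.span ℂ {1}
  let W₂ : Submodule ℂ (Module.End ℂ V) := Submodule.span ℂ (ρ '' Z)
  let W₃ : Submodule ℂ (Module.End ℂ V) := Submodule.span ℂ (ρ '' K)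
  have h12 : W₁ ≤ W₂ := by
    refine Submodule.span_mono ?_
    rw [Set.singleton_subset_iff]
    exact ⟨1, Z.one_mem, map_one ρ⟩
  have hz₀W : ρ z₀ ∈ W₂ := Submodule.subset_span ⟨z₀, hZmem.2 ⟨hz₀, hz₀c⟩, rfl⟩
  have h12' : W₁ < W₂ := by
    refine lt_of_le_of_ne h12 fun h => ?_
    rw [← h] at hz₀W
    obtain ⟨c, hc⟩ := Submodule.mem_span_singleton.1 hz₀W
    exact hz₀s c hc.symm
  have h23 : W₂ < W₃ := by
    refine lt_of_le_of_ne (Submodule.span_mono (Set.image_mono inf_le_left)) fun h => ?_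
    have hx : ρ x₀ ∈ W₂ := by rw [h]; exact Submodule.subset_span ⟨x₀, hx₀, rfl⟩
    have : Commute (ρ x₀) (ρ y₀) := by
      refine commute_of_mem_span hx ?_
      rintro _ ⟨z, hz, rfl⟩
      exact ((hZmem.1 hz).2 y₀ hy₀).map ρ
    apply hxy
    apply hinj
    simpa only [map_mul] using this.eq
  -- If `ρ(K)` spanned `End V`, the central element `z₀` would commute with every endomorphism and
  -- be scalar.
  have h34 : W₃ < ⊤ := by
    refine lt_top_iff_ne_top.2 fun h => ?_
    have hcent : ρ z₀ ∈ Subalgebra.center ℂ (Module.End ℂ V) := by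
      rw [Subalgebra.mem_center_iff]
      intro X
      have hX : X ∈ W₃ := by rw [h]; exact Submodule.mem_top
      refine (commute_of_mem_span hX ?_).eq
      rintro _ ⟨k, hk, rfl⟩
      exact ((hz₀c k hk).map ρ).symm
    rw [Algebra.IsCentral.center_eq_bot, Algebra.mem_bot] at hcent
    obtain ⟨c, hc⟩ := hcent
    exact hz₀s c (by rw [← hc, Algebra.algebraMap_eq_smul_one])
  -- This excludes `V = 0`, where `1 = 0` would make `ρ z₀` scalar.
  have h01 : ⊥ < W₁ := by
    rw [bot_lt_iff_ne_bot, Ne, Submodule.span_singleton_eq_bot]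
    intro h
    refine hz₀s 0 ?_
    rw [← mul_one (ρ z₀), h, mul_zero, smul_zero]
  have hW₁ (g : G) (X : Module.End ℂ V) (hX : X ∈ W₁) : ρ.linHom ρ g X ∈ W₁ := by
    obtain ⟨c, rfl⟩ := Submodule.mem_span_singleton.1 hX
    refine Submodule.mem_span_singleton.2 ⟨c, ?_⟩
    ext v
    simp
  have h4 := (hρ.linHom hρ).four_le_finrank_invariants_linHom (W₁ := W₁) (W₂ := W₂) (W₃ := W₃)
    hW₁ (fun g _ => linHom_mem_span_image ρ Z g) (fun g _ => linHom_mem_span_image ρ K g)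
    h01 h12' h23 h34
  have := hdual.finrank_invariants_le
  omega

end Main

end Representation

theorem mainTheorem10
    {E : Type*} [NormedAddCommGroup E] [NormedSpace ℝ E] [FiniteDimensional ℝ E]
    {G : Type*} [Group G] [TopologicalSpace G] [IsTopologicalGroup G]
    [ChartedSpace E G] [LieGroup 𝓘(ℝ, E) ∞ G] [T2Space G] [CompactSpace G]
    {V : Type*} [AddCommGroup V] [Module ℂ V] [FiniteDimensional ℂ V]
    (ρ : Representation ℂ G V) (hcont : ρ.IsContinuous)
    (hfaithful : Function.Injective ρ) (hdual : ρ.IsSelfDual)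
    (ha : ρ.satoTateMoment 4 = 3) :
    IsTorusGroup (Subgroup.connectedComponentOfOne G) ∨
      IsSemisimpleGroup (Subgroup.connectedComponentOfOne G) := by
  let K := Subgroup.connectedComponentOfOne G
  have hclosed : IsClosed (K : Set G) := isClosed_connectedComponent
  have : CompactSpace K := isCompact_iff_compactSpace.1 hclosed.isCompact
  have : ConnectedSpace K :=
    isConnected_iff_connectedSpace.1 (isConnected_connectedComponent (x := (1 : G)))
  let σ : Representation ℂ K V := ρ.comp K.subtype
  have hσ : σ.IsContinuous := fun v f => (hcont v f).comp continuous_subtype_val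
  have hσinj : Function.Injective σ := hfaithful.comp Subtype.val_injective
  -- The moment bound concerns `G`, so the dichotomy is applied to `K` as a normal subgroup of `G`;
  -- only afterwards is `ρ` restricted to `K`.
  rcases hcont.commute_or_center_scalar hfaithful hdual ha.le K with hcomm | hscal
  · left
    exact hσ.isTorusGroup hσinj fun x y => Subtype.ext (hcomm x x.2 y y.2)
  · right
    obtain ⟨B, hB⟩ := hdual.exists_form
    refine hσ.isSemisimpleGroup hσinj B (fun g v w => hB g v w) fun z hz => ?_
    exact hscal z z.2 fun k hk => congrArg Subtype.val (hz ⟨k, hk⟩)
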